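/- Let $S$ be a connected smooth surface, immersed in the unit sphere $\mathbb{S}^3\subset\mathbb{R}^4$ and oriented by a smooth unit normal field $e_3$ tangent to $\mathbb{S}^3$. For an orthonormal tangent frame $(e_1,e_2)$ of $S$ on an open subset, put $\theta^i=\langle dx,e_i\rangle$ and $\omega_i^j=\langle de_i,e_j\rangle$, where $x$ is the position vector in $\mathbb{R}^4$. The principal curvatures $\lambda_1,\lambda_2$ at a point are the diagonal entries of the second fundamental form $-\langle de_3,dx\rangle$ in an orthonormal basis of the tangent plane that diagonalizes it; a frame is principal if $\omega_1^3=\lambda_1\theta^1$ and $\omega_2^3=\lambda_2\theta^2$. The Gaussian curvature $K$ is the function with $d\omega_2^1=K\,\theta^1\wedge\theta^2$ for every orthonormal tangent frame. Suppose that the principal curvatures $\lambda_1,\lambda_2$ of $S$ are constant. Then at least one of the following holds. 1. $\lambda_1=\lambda_2$, and $S$ is umbilic (at each point the second fundamental form is a multiple of the first). 2. Smooth principal frames exist around every point of $S$; the connection form $\omega_1^2$ of every principal frame vanishes; and the Gaussian curvature of $S$ is $K=1+\lambda_1\lambda_2=0$. -/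

import Mathlib

open scoped Manifold ContDiff RealInnerProductSpace

noncomputable section

namespace S3Surface

/-- The plane on which the surfaces are modelled. -/
abbrev R2 := EuclideanSpace ℝ (Fin 2)

/-- The Euclidean space containing the unit sphere `S³`. -/
abbrev R4 := EuclideanSpace ℝ (Fin 4)

variable {M : Type*} [TopologicalSpace M] [ChartedSpace R2 M]

/-- The differential at `p` of a vector-valued map `F : M → ℝ⁴`. -/
def diffl (F : M → R4) (p : M) : TangentSpace (𝓡 2) p →L[ℝ] R4 :=
  mfderiv (𝓡 2) 𝓘(ℝ, R4) F p

/-- `f : M → ℝ⁴` is a smooth immersion of the surface `M` into the unit sphere `S³`,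
oriented by the smooth unit normal field `N` (tangent to `S³` and orthogonal to the surface). -/
structure IsOrientedSurface (f N : M → R4) : Prop where
  contMDiff : ContMDiff (𝓡 2) 𝓘(ℝ, R4) ∞ f
  immersion : ∀ p, Function.Injective (diffl f p)
  mem_sphere : ∀ p, f p ∈ Metric.sphere (0 : R4) 1
  contMDiff_normal : ContMDiff (𝓡 2) 𝓘(ℝ, R4) ∞ N
  norm_normal : ∀ p, ‖N p‖ = 1
  normal_tangent_sphere : ∀ p, ⟪f p, N p⟫ = 0
  normal_orthogonal : ∀ p (v : TangentSpace (𝓡 2) p), ⟪diffl f p v, N p⟫ = 0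

/-- First fundamental form: the metric induced by `f`. -/
def firstForm (f : M → R4) (p : M) (v w : TangentSpace (𝓡 2) p) : ℝ :=
  ⟪diffl f p v, diffl f p w⟫

/-- Second fundamental form with respect to the unit normal `N`. -/
def secondForm (f N : M → R4) (p : M) (v w : TangentSpace (𝓡 2) p) : ℝ :=
  -⟪diffl N p v, diffl f p w⟫

/-- `l₁`, `l₂` are the principal curvatures at `p`: some orthonormal basis `v₁, v₂` of the
tangent plane diagonalizes the second fundamental form, with diagonal entries `l₁, l₂`. -/
def ArePrincipalCurvaturesAt (f N : M → R4) (p : M) (l₁ l₂ : ℝ) : Prop :=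
  ∃ v₁ v₂ : TangentSpace (𝓡 2) p,
    firstForm f p v₁ v₁ = 1 ∧ firstForm f p v₂ v₂ = 1 ∧ firstForm f p v₁ v₂ = 0 ∧
    secondForm f N p v₁ v₁ = l₁ ∧ secondForm f N p v₂ v₂ = l₂ ∧
    secondForm f N p v₁ v₂ = 0 ∧ secondForm f N p v₂ v₁ = 0

/-- Umbilic surface: at every point the second fundamental form is a multiple of the first. -/
def IsUmbilic (f N : M → R4) : Prop :=
  ∀ p, ∃ c : ℝ, ∀ v w : TangentSpace (𝓡 2) p, secondForm f N p v w = c * firstForm f p v w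

/-- `(e₁, e₂)` is a smooth orthonormal frame of the tangent planes of the surface over the
open set `U`; the vectors are regarded as vectors of `ℝ⁴`. -/
structure IsTangentFrameOn (f : M → R4) (U : Set M) (e₁ e₂ : M → R4) : Prop where
  isOpen : IsOpen U
  contMDiffOn_fst : ContMDiffOn (𝓡 2) 𝓘(ℝ, R4) ∞ e₁ U
  contMDiffOn_snd : ContMDiffOn (𝓡 2) 𝓘(ℝ, R4) ∞ e₂ U
  tangent_fst : ∀ p ∈ U, ∃ v : TangentSpace (𝓡 2) p, diffl f p v = e₁ p
  tangent_snd : ∀ p ∈ U, ∃ v : TangentSpace (𝓡 2) p, diffl f p v = e₂ p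
  norm_fst : ∀ p ∈ U, ‖e₁ p‖ = 1
  norm_snd : ∀ p ∈ U, ‖e₂ p‖ = 1
  orthogonal : ∀ p ∈ U, ⟪e₁ p, e₂ p⟫ = 0

/-- The coframe form `θ` dual to the frame field `e`, `θ(v) = ⟨df(v), e⟩`. -/
def coframe (f e : M → R4) (p : M) : TangentSpace (𝓡 2) p →L[ℝ] ℝ :=
  (innerSL ℝ (e p)).comp (diffl f p)

/-- The connection form `ω_i^j`, the `e_j`-component of `de_i`: `connForm e_i e_j = ⟨de_i, e_j⟩`. -/
def connForm (ei ej : M → R4) (p : M) : TangentSpace (𝓡 2) p →L[ℝ] ℝ :=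
  (innerSL ℝ (ej p)).comp (diffl ei p)

/-- Principal frame over `U`: an orthonormal tangent frame which, completed by `e₃ = N`, satisfies
`ω_1^3 = l₁ θ^1` and `ω_2^3 = l₂ θ^2`. -/
structure IsPrincipalFrameOn (f N : M → R4) (l₁ l₂ : ℝ) (U : Set M) (e₁ e₂ : M → R4) : Prop
    extends IsTangentFrameOn f U e₁ e₂ where
  diag_fst : ∀ p ∈ U, connForm e₁ N p = l₁ • coframe f e₁ p
  diag_snd : ∀ p ∈ U, connForm e₂ N p = l₂ • coframe f e₂ p

/-- The expression in the preferred chart at `p` of a one-form on `M`. -/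
def formInChart (α : (q : M) → TangentSpace (𝓡 2) q →L[ℝ] ℝ) (p : M) (y : R2) : R2 →L[ℝ] ℝ :=
  (α ((extChartAt (𝓡 2) p).symm y)).comp
    (mfderiv 𝓘(ℝ, R2) (𝓡 2) (extChartAt (𝓡 2) p).symm y)

/-- The exterior derivative at `p` of a one-form on `M`, computed in the preferred chart at `p`. -/
def extDerivOneForm (α : (q : M) → TangentSpace (𝓡 2) q →L[ℝ] ℝ) (p : M)
    (v w : TangentSpace (𝓡 2) p) : ℝ :=
  let φ := extChartAt (𝓡 2) p
  let dφ : TangentSpace (𝓡 2) p →L[ℝ] R2 := mfderiv (𝓡 2) 𝓘(ℝ, R2) φ p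
  fderiv ℝ (formInChart α p) (φ p) (dφ v) (dφ w) - fderiv ℝ (formInChart α p) (φ p) (dφ w) (dφ v)

/-- The wedge product of two one-forms at a point, evaluated on two vectors. -/
def wedge {p : M} (α β : TangentSpace (𝓡 2) p →L[ℝ] ℝ) (v w : TangentSpace (𝓡 2) p) : ℝ :=
  α v * β w - α w * β v

/-- `K` is the Gaussian curvature at `p` of the metric induced by `f`:
`dω_2^1 = K θ^1 ∧ θ^2` at `p`, for every orthonormal tangent frame defined around `p`. -/
def IsGaussianCurvatureAt (f : M → R4) (p : M) (K : ℝ) : Prop :=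
  ∀ (U : Set M) (e₁ e₂ : M → R4), IsTangentFrameOn f U e₁ e₂ → p ∈ U →
    ∀ v w : TangentSpace (𝓡 2) p,
      extDerivOneForm (connForm e₂ e₁) p v w
        = K * wedge (coframe f e₁ p) (coframe f e₂ p) v w

end S3Surface

end

open S3Surface

open S3Surface

noncomputable section

namespace S3Surface

/-! ### Differentials along the surface, Weingarten formula, umbilic case. -/

section

/-! If `l₁ = l₂ = l`, the Weingarten formula reads `dN = -l df`, which is umbilicity.

If `l₁ ≠ l₂`, everything rests on `dN + l₂ df = (l₂ - l₁) θ¹ e₁`: the left side kills the second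
principal direction. Applied to a fixed chart direction, it is a smooth field along the first
principal line, and normalizing it where it is nonzero gives smooth principal frames
(`exists_isPrincipalFrameOn`).

Because `l₂` is constant, the same form is the differential of the map `N + l₂ f`, and `e₂` is
normal along that map. Symmetry of second derivatives (`inner_fderiv_symm`) then yields the Codazzi
equation `θ¹ ∧ ω₂¹ = 0`. Exchanging the indices gives `θ² ∧ ω₁² = 0`, and the two together force
`ω₁² = 0`.

The Gauss equation `K = 1 + l₁ l₂` comes from `dω₂¹ = ⟨de₁ ∧ de₂⟩`, expanded in the orthonormal
basis `e₁, e₂, N, f` of `ℝ⁴`. Since `ω₂¹` vanishes identically for a principal frame, `K = 0`. -/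

theorem orthonormal_expansion {a b c d : R4} (ha : ‖a‖ = 1) (hb : ‖b‖ = 1) (hc : ‖c‖ = 1)
    (hd : ‖d‖ = 1) (hab : ⟪a, b⟫ = 0) (hac : ⟪a, c⟫ = 0) (had : ⟪a, d⟫ = 0) (hbc : ⟪b, c⟫ = 0)
    (hbd : ⟪b, d⟫ = 0) (hcd : ⟪c, d⟫ = 0) (x : R4) :
    x = ⟪x, a⟫ • a + ⟪x, b⟫ • b + ⟪x, c⟫ • c + ⟪x, d⟫ • d := by
  have ho : Orthonormal ℝ ![a, b, c, d] := by
    rw [orthonormal_iff_ite]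
    intro i j
    fin_cases i <;> fin_cases j <;>
      simp [ha, hb, hc, hd, hab, hac, had, hbc, hbd, hcd, real_inner_comm a, real_inner_comm b,
        real_inner_comm c]
  have hcard : Fintype.card (Fin 4) = Module.finrank ℝ R4 := by simp
  let B := (basisOfOrthonormalOfCardEqFinrank ho hcard)
  have hB : ⇑B = ![a, b, c, d] := coe_basisOfOrthonormalOfCardEqFinrank ho hcard
  let O := B.toOrthonormalBasis (by rw [hB]; exact ho)
  have hO : ⇑O = ![a, b, c, d] := by simp [O, hB]
  have h := O.sum_repr' x
  simp only [hO, Fin.sum_univ_four] at h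
  simpa [real_inner_comm] using h.symm

variable {M : Type*} [TopologicalSpace M] [ChartedSpace R2 M]

/-- The expression of `F` in the preferred chart at `p`. -/
def inChart (F : M → R4) (p : M) : R2 → R4 := F ∘ (extChartAt (𝓡 2) p).symm

theorem differentiableAt_inChart {F : M → R4} {p : M}
    (hF : MDifferentiableAt (𝓡 2) 𝓘(ℝ, R4) F p) :
    DifferentiableAt ℝ (inChart F p) (extChartAt (𝓡 2) p p) := by
  have h : DifferentiableWithinAt ℝ (inChart F p) (Set.range (𝓡 2)) (extChartAt (𝓡 2) p p) :=
    hF.differentiableWithinAt_writtenInExtChartAt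
  rwa [ModelWithCorners.range_eq_univ, differentiableWithinAt_univ] at h

theorem diffl_eq_fderiv {F : M → R4} {p : M} (hF : MDifferentiableAt (𝓡 2) 𝓘(ℝ, R4) F p)
    (v : TangentSpace (𝓡 2) p) :
    diffl F p v = fderiv ℝ (inChart F p) (extChartAt (𝓡 2) p p) v := by
  have h : mfderiv (𝓡 2) 𝓘(ℝ, R4) F p = fderivWithin ℝ (inChart F p) (Set.range (𝓡 2))
    (extChartAt (𝓡 2) p p) := if_pos hF
  rw [ModelWithCorners.range_eq_univ, fderivWithin_univ] at h
  exact congrArg (fun L => L v) h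

/-- Product rule for a locally constant inner product. -/
theorem inner_diffl_add_eq_zero {F G : M → R4} {p : M}
    (hF : MDifferentiableAt (𝓡 2) 𝓘(ℝ, R4) F p) (hG : MDifferentiableAt (𝓡 2) 𝓘(ℝ, R4) G p)
    {c : ℝ} (h : ∀ᶠ q in nhds p, ⟪F q, G q⟫ = c) (v : TangentSpace (𝓡 2) p) :
    ⟪diffl F p v, G p⟫ + ⟪F p, diffl G p v⟫ = 0 := by
  rw [diffl_eq_fderiv hF, diffl_eq_fderiv hG]
  have h1 := fderiv_inner_apply ℝ (differentiableAt_inChart hF) (differentiableAt_inChart hG) v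
  have h2 : (fun y => ⟪inChart F p y, inChart G p y⟫)
      =ᶠ[nhds (extChartAt (𝓡 2) p p)] fun _ => c := by
    have := (continuousAt_extChartAt_symm (I := 𝓡 2) p)
    rw [ContinuousAt, extChartAt_to_inv] at this
    exact this.eventually h
  rw [h2.fderiv_eq] at h1
  simp only [fderiv_fun_const, inChart, Function.comp_apply, extChartAt_to_inv] at h1
  exact ((add_comm _ _).trans h1.symm)

namespace IsOrientedSurface

variable {f N : M → R4} (hS : IsOrientedSurface f N)
include hS

theorem mdiff (p : M) : MDifferentiableAt (𝓡 2) 𝓘(ℝ, R4) f p :=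
  hS.contMDiff.mdifferentiableAt (by simp)

theorem mdiff_normal (p : M) : MDifferentiableAt (𝓡 2) 𝓘(ℝ, R4) N p :=
  hS.contMDiff_normal.mdifferentiableAt (by simp)

theorem norm_eq_one (p : M) : ‖f p‖ = 1 := by simpa using hS.mem_sphere p

theorem inner_diffl_self (p : M) (v : TangentSpace (𝓡 2) p) : ⟪diffl f p v, f p⟫ = 0 := by
  have := inner_diffl_add_eq_zero (hS.mdiff p) (hS.mdiff p) (c := 1)
    (.of_forall fun q => by rw [real_inner_self_eq_norm_sq, hS.norm_eq_one]; norm_num) v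
  rw [real_inner_comm (diffl f p v)] at this
  linarith

theorem inner_diffl_normal_normal (p : M) (v : TangentSpace (𝓡 2) p) :
    ⟪diffl N p v, N p⟫ = 0 := by
  have := inner_diffl_add_eq_zero (hS.mdiff_normal p) (hS.mdiff_normal p) (c := 1)
    (.of_forall fun q => by rw [real_inner_self_eq_norm_sq, hS.norm_normal]; norm_num) v
  rw [real_inner_comm (diffl N p v)] at this
  linarith

theorem inner_diffl_normal_self (p : M) (v : TangentSpace (𝓡 2) p) :
    ⟪diffl N p v, f p⟫ = 0 := by
  have := inner_diffl_add_eq_zero (hS.mdiff p) (hS.mdiff_normal p) (c := 0)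
    (.of_forall fun q => hS.normal_tangent_sphere q) v
  rw [hS.normal_orthogonal, real_inner_comm] at this
  linarith

end IsOrientedSurface

/-- Orthonormal principal directions `u₁ = df(v₁)`, `u₂ = df(v₂)` with the Weingarten formula. -/
theorem exists_principal_directions {f N : M → R4} (hS : IsOrientedSurface f N) {p : M}
    {l₁ l₂ : ℝ} (h : ArePrincipalCurvaturesAt f N p l₁ l₂) :
    ∃ v₁ v₂ : TangentSpace (𝓡 2) p, ‖diffl f p v₁‖ = 1 ∧ ‖diffl f p v₂‖ = 1 ∧
      ⟪diffl f p v₁, diffl f p v₂⟫ = 0 ∧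
      (∀ v, v = ⟪diffl f p v, diffl f p v₁⟫ • v₁ + ⟪diffl f p v, diffl f p v₂⟫ • v₂) ∧
      diffl N p v₁ = -l₁ • diffl f p v₁ ∧ diffl N p v₂ = -l₂ • diffl f p v₂ := by
  obtain ⟨v₁, v₂, h11, h22, h12, s11, s22, s12, s21⟩ := h
  simp only [firstForm, secondForm] at *
  have n1 : ‖diffl f p v₁‖ = 1 := by
    rw [real_inner_self_eq_norm_sq] at h11; nlinarith [norm_nonneg (diffl f p v₁)]
  have n2 : ‖diffl f p v₂‖ = 1 := by
    rw [real_inner_self_eq_norm_sq] at h22; nlinarith [norm_nonneg (diffl f p v₂)]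
  have ex := orthonormal_expansion n1 n2 (hS.norm_normal p) (hS.norm_eq_one p) h12
    (hS.normal_orthogonal p v₁) (hS.inner_diffl_self p v₁) (hS.normal_orthogonal p v₂)
    (hS.inner_diffl_self p v₂) (by rw [real_inner_comm]; exact hS.normal_tangent_sphere p)
  refine ⟨v₁, v₂, n1, n2, h12, fun v => ?_, ?_, ?_⟩
  · apply hS.immersion p
    rw [map_add, map_smul, map_smul]
    conv_lhs => rw [ex (diffl f p v)]
    simp [hS.normal_orthogonal, hS.inner_diffl_self]
  · conv_lhs => rw [ex (diffl N p v₁)]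
    rw [hS.inner_diffl_normal_normal, hS.inner_diffl_normal_self, ← s11, neg_eq_zero.1 s12]
    simp
  · conv_lhs => rw [ex (diffl N p v₂)]
    rw [hS.inner_diffl_normal_normal, hS.inner_diffl_normal_self, ← s22, neg_eq_zero.1 s21]
    simp

theorem isUmbilic_of_eq {f N : M → R4} (hS : IsOrientedSurface f N) {l : ℝ}
    (h : ∀ p, ArePrincipalCurvaturesAt f N p l l) : IsUmbilic f N := by
  intro p
  obtain ⟨v₁, v₂, -, -, -, hv, w1, w2⟩ := exists_principal_directions hS (h p)
  refine ⟨l, fun v w => ?_⟩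
  have : diffl N p v = -l • diffl f p v := by
    rw [hv v]
    simp only [map_add, map_smul, w1, w2, smul_add, smul_comm _ (-l)]
  rw [secondForm, this, firstForm, inner_smul_left]
  simp

end

/-! ### Calculus in a chart, and symmetry of second derivatives. -/

section

variable {M : Type*} [TopologicalSpace M] [ChartedSpace R2 M]

theorem eventually_inChart {p : M} {P : M → Prop} (h : ∀ᶠ q in nhds p, P q) :
    ∀ᶠ y in nhds (extChartAt (𝓡 2) p p), y ∈ (extChartAt (𝓡 2) p).target ∧
      P ((extChartAt (𝓡 2) p).symm y) := by
  have := continuousAt_extChartAt_symm (I := 𝓡 2) p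
  rw [ContinuousAt, extChartAt_to_inv] at this
  filter_upwards [extChartAt_target_mem_nhds (I := 𝓡 2) p, this.eventually h] with y h1 h2
  exact ⟨h1, h2⟩

/-- Unlike `diffl_eq_fderiv`, which reads a tangent vector directly as a vector of the model, this
passes through the differential of the chart, as `extDerivOneForm` does. -/
theorem fderiv_inChart_mfderiv {F : M → R4} {p : M}
    (hF : MDifferentiableAt (𝓡 2) 𝓘(ℝ, R4) F p) (v : TangentSpace (𝓡 2) p) :
    fderiv ℝ (inChart F p) (extChartAt (𝓡 2) p p)
      (mfderiv (𝓡 2) 𝓘(ℝ, R2) (extChartAt (𝓡 2) p) p v) = diffl F p v := by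
  have hφ : MDifferentiableAt (𝓡 2) 𝓘(ℝ, R2) (extChartAt (𝓡 2) p) p :=
    (contMDiffAt_extChartAt (n := ∞)).mdifferentiableAt (by simp)
  have hE : MDifferentiableAt 𝓘(ℝ, R2) 𝓘(ℝ, R4) (inChart F p) (extChartAt (𝓡 2) p p) :=
    (differentiableAt_inChart hF).mdifferentiableAt
  have h := mfderiv_comp_apply p hE hφ v
  rw [mfderiv_eq_fderiv] at h
  have he : inChart F p ∘ extChartAt (𝓡 2) p =ᶠ[nhds p] F := by
    filter_upwards [extChartAt_source_mem_nhds (I := 𝓡 2) p] with q hq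
    simp only [inChart, Function.comp_apply, (extChartAt (𝓡 2) p).left_inv hq]
  rw [he.mfderiv_eq] at h
  exact h.symm

variable [IsManifold (𝓡 2) ∞ M]

theorem fderiv_inChart {F : M → R4} {p : M} {y : R2} (hy : y ∈ (extChartAt (𝓡 2) p).target)
    (hF : MDifferentiableAt (𝓡 2) 𝓘(ℝ, R4) F ((extChartAt (𝓡 2) p).symm y)) (w : R2) :
    fderiv ℝ (inChart F p) y w = diffl F ((extChartAt (𝓡 2) p).symm y)
      (mfderiv 𝓘(ℝ, R2) (𝓡 2) (extChartAt (𝓡 2) p).symm y w) := by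
  have hφ : MDifferentiableAt 𝓘(ℝ, R2) (𝓡 2) (extChartAt (𝓡 2) p).symm y :=
    ((contMDiffOn_extChartAt_symm (n := ∞) p).contMDiffAt
      ((isOpen_extChartAt_target p).mem_nhds hy)).mdifferentiableAt (by simp)
  rw [← mfderiv_eq_fderiv]
  exact mfderiv_comp_apply y hF hφ w

theorem contDiffAt_inChart {F : M → R4} {p : M} {y : R2}
    (hy : y ∈ (extChartAt (𝓡 2) p).target)
    (hF : ContMDiffAt (𝓡 2) 𝓘(ℝ, R4) ∞ F ((extChartAt (𝓡 2) p).symm y)) :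
    ContDiffAt ℝ ∞ (inChart F p) y := by
  rw [← contMDiffAt_iff_contDiffAt]
  exact hF.comp y ((contMDiffOn_extChartAt_symm (n := ∞) p).contMDiffAt
      ((isOpen_extChartAt_target p).mem_nhds hy))

theorem contDiffAt_inChart_self {F : M → R4} {p : M}
    (hF : ContMDiffAt (𝓡 2) 𝓘(ℝ, R4) ∞ F p) :
    ContDiffAt ℝ ∞ (inChart F p) (extChartAt (𝓡 2) p p) :=
  contDiffAt_inChart (mem_extChartAt_target p) (by rwa [extChartAt_to_inv])

/-- A chart direction `w` is the chart expression of a tangent vector, at every point of the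
source of the chart. -/
theorem exists_tangent_of_chart_direction {p q : M} (hq : q ∈ (extChartAt (𝓡 2) p).source)
    (w : R2) : ∃ x : TangentSpace (𝓡 2) q, ∀ F : M → R4,
      MDifferentiableAt (𝓡 2) 𝓘(ℝ, R4) F q →
        fderiv ℝ (inChart F p) (extChartAt (𝓡 2) p q) w = diffl F q x := by
  obtain ⟨y, hy, rfl⟩ : ∃ y ∈ (extChartAt (𝓡 2) p).target, (extChartAt (𝓡 2) p).symm y = q :=
    ⟨_, (extChartAt (𝓡 2) p).map_source hq, (extChartAt (𝓡 2) p).left_inv hq⟩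
  rw [(extChartAt (𝓡 2) p).right_inv hy]
  exact ⟨_, fun F hF => fderiv_inChart hy hF w⟩

/-- If `E` is a normal field along `g`, then `⟨dg, dE⟩` is symmetric. -/
theorem inner_fderiv_symm {g E : R2 → R4} {y : R2} (hg : ContDiffAt ℝ ∞ g y)
    (hE : DifferentiableAt ℝ E y) (h : ∀ᶠ z in nhds y, ∀ v, ⟪fderiv ℝ g z v, E z⟫ = 0)
    (v w : R2) : ⟪fderiv ℝ g y v, fderiv ℝ E y w⟫ = ⟪fderiv ℝ g y w, fderiv ℝ E y v⟫ := by
  have hd : DifferentiableAt ℝ (fderiv ℝ g) y :=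
    (hg.fderiv_right (m := 1) (WithTop.coe_le_coe.2 le_top)).differentiableAt (by simp)
  -- Differentiate `⟨dg(v), E⟩ = 0` in the direction `w`; the remaining term is a second derivative
  -- of `g`, hence symmetric in `v, w`.
  have key : ∀ v w : R2, ⟪fderiv ℝ g y v, fderiv ℝ E y w⟫
      + ⟪fderiv ℝ (fderiv ℝ g) y w v, E y⟫ = 0 := by
    intro v w
    have h1 := fderiv_inner_apply ℝ (hd.clm_apply (differentiableAt_const v)) hE w
    have h2 : (fun z => ⟪fderiv ℝ g z v, E z⟫) =ᶠ[nhds y] fun _ => 0 := h.mono fun z hz => hz v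
    rw [h2.fderiv_eq, fderiv_clm_apply hd (differentiableAt_const v)] at h1
    simpa using h1.symm
  have hs : fderiv ℝ (fderiv ℝ g) y w v = fderiv ℝ (fderiv ℝ g) y v w :=
    (hg.isSymmSndFDerivAt (by
      rw [minSmoothness_of_isRCLikeNormedField]
      exact WithTop.coe_le_coe.2 (le_top : (2 : ℕ∞) ≤ ⊤))) w v
  have h1 := key v w
  have h2 := key w v
  rw [hs] at h1
  linarith

end

/-! ### Moving frames: the Gauss and Codazzi equations. -/

section

variable {M : Type*} [TopologicalSpace M] [ChartedSpace R2 M]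

theorem connForm_apply (ei ej : M → R4) (p : M) (v : TangentSpace (𝓡 2) p) :
    connForm ei ej p v = ⟪diffl ei p v, ej p⟫ :=
  real_inner_comm (diffl ei p v) (ej p)

theorem coframe_apply (f e : M → R4) (p : M) (v : TangentSpace (𝓡 2) p) :
    coframe f e p v = ⟪diffl f p v, e p⟫ :=
  real_inner_comm (diffl f p v) (e p)

namespace IsTangentFrameOn

variable {f N : M → R4} {U : Set M} {e₁ e₂ : M → R4} (h : IsTangentFrameOn f U e₁ e₂)
include h

theorem contMDiffAt_fst {p : M} (hp : p ∈ U) : ContMDiffAt (𝓡 2) 𝓘(ℝ, R4) ∞ e₁ p :=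
  h.contMDiffOn_fst.contMDiffAt (h.isOpen.mem_nhds hp)

theorem contMDiffAt_snd {p : M} (hp : p ∈ U) : ContMDiffAt (𝓡 2) 𝓘(ℝ, R4) ∞ e₂ p :=
  h.contMDiffOn_snd.contMDiffAt (h.isOpen.mem_nhds hp)

theorem mdiff_fst {p : M} (hp : p ∈ U) : MDifferentiableAt (𝓡 2) 𝓘(ℝ, R4) e₁ p :=
  (h.contMDiffAt_fst hp).mdifferentiableAt (by simp)

theorem mdiff_snd {p : M} (hp : p ∈ U) : MDifferentiableAt (𝓡 2) 𝓘(ℝ, R4) e₂ p :=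
  (h.contMDiffAt_snd hp).mdifferentiableAt (by simp)

theorem symm : IsTangentFrameOn f U e₂ e₁ :=
  ⟨h.isOpen, h.contMDiffOn_snd, h.contMDiffOn_fst, h.tangent_snd, h.tangent_fst, h.norm_snd,
    h.norm_fst, fun p hp => by rw [real_inner_comm]; exact h.orthogonal p hp⟩

theorem inner_diffl_fst_fst {p : M} (hp : p ∈ U) (v : TangentSpace (𝓡 2) p) :
    ⟪diffl e₁ p v, e₁ p⟫ = 0 := by
  have := inner_diffl_add_eq_zero (h.mdiff_fst hp) (h.mdiff_fst hp) (c := 1) (by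
    filter_upwards [h.isOpen.mem_nhds hp] with q hq
    rw [real_inner_self_eq_norm_sq, h.norm_fst q hq]; norm_num) v
  rw [real_inner_comm (diffl e₁ p v)] at this
  linarith

theorem inner_diffl_snd_fst {p : M} (hp : p ∈ U) (v : TangentSpace (𝓡 2) p) :
    ⟪diffl e₂ p v, e₁ p⟫ = -⟪diffl e₁ p v, e₂ p⟫ := by
  have := inner_diffl_add_eq_zero (h.mdiff_fst hp) (h.mdiff_snd hp) (c := 0) (by
    filter_upwards [h.isOpen.mem_nhds hp] with q hq using h.orthogonal q hq) v
  rw [real_inner_comm (diffl e₂ p v)] at this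
  linarith

variable (hS : IsOrientedSurface f N)
include hS

theorem inner_fst_normal {p : M} (hp : p ∈ U) : ⟪e₁ p, N p⟫ = 0 := by
  obtain ⟨v, hv⟩ := h.tangent_fst p hp
  rw [← hv, hS.normal_orthogonal]

theorem inner_fst_self {p : M} (hp : p ∈ U) : ⟪e₁ p, f p⟫ = 0 := by
  obtain ⟨v, hv⟩ := h.tangent_fst p hp
  rw [← hv, hS.inner_diffl_self]

theorem inner_diffl_fst_normal {p : M} (hp : p ∈ U) (v : TangentSpace (𝓡 2) p) :
    ⟪diffl e₁ p v, N p⟫ = -⟪diffl N p v, e₁ p⟫ := by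
  have := inner_diffl_add_eq_zero (h.mdiff_fst hp) (hS.mdiff_normal p) (c := 0) (by
    filter_upwards [h.isOpen.mem_nhds hp] with q hq using h.inner_fst_normal hS hq) v
  rw [real_inner_comm (diffl N p v)] at this
  linarith

/-- The component of `de₁` along the position vector is `-θ¹`; it is the source of the summand `1`
in the Gauss equation. -/
theorem inner_diffl_fst_self {p : M} (hp : p ∈ U) (v : TangentSpace (𝓡 2) p) :
    ⟪diffl e₁ p v, f p⟫ = -⟪diffl f p v, e₁ p⟫ := by
  have := inner_diffl_add_eq_zero (h.mdiff_fst hp) (hS.mdiff p) (c := 0) (by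
    filter_upwards [h.isOpen.mem_nhds hp] with q hq using h.inner_fst_self hS hq) v
  rw [real_inner_comm (diffl f p v)] at this
  linarith

theorem expansion {p : M} (hp : p ∈ U) (x : R4) :
    x = ⟪x, e₁ p⟫ • e₁ p + ⟪x, e₂ p⟫ • e₂ p + ⟪x, N p⟫ • N p + ⟪x, f p⟫ • f p :=
  orthonormal_expansion (h.norm_fst p hp) (h.norm_snd p hp) (hS.norm_normal p) (hS.norm_eq_one p)
    (h.orthogonal p hp) (h.inner_fst_normal hS hp) (h.inner_fst_self hS hp)
    (h.symm.inner_fst_normal hS hp) (h.symm.inner_fst_self hS hp)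
    (by rw [real_inner_comm]; exact hS.normal_tangent_sphere p) x

end IsTangentFrameOn

/-- `dω₂¹ = ⟨de₁ ∧ de₂⟩`. -/
theorem extDerivOneForm_connForm [IsManifold (𝓡 2) ∞ M] {f : M → R4} {U : Set M} {e₁ e₂ : M → R4}
    (h : IsTangentFrameOn f U e₁ e₂) {p : M} (hp : p ∈ U) (v w : TangentSpace (𝓡 2) p) :
    extDerivOneForm (connForm e₂ e₁) p v w
      = ⟪diffl e₁ p v, diffl e₂ p w⟫ - ⟪diffl e₁ p w, diffl e₂ p v⟫ := by
  set y := extChartAt (𝓡 2) p p with hy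
  have hc : formInChart (connForm e₂ e₁) p =ᶠ[nhds y]
      fun z => (innerSL ℝ (inChart e₁ p z)).comp (fderiv ℝ (inChart e₂ p) z) := by
    -- The chart expression is needed on a whole neighbourhood, since it is about to be
    -- differentiated.
    filter_upwards [eventually_inChart (h.isOpen.mem_nhds hp)] with z hz
    ext a
    simp only [ContinuousLinearMap.comp_apply]
    rw [fderiv_inChart hz.1 (h.mdiff_snd hz.2)]
    rfl
  have d1 : DifferentiableAt ℝ (inChart e₁ p) y := differentiableAt_inChart (h.mdiff_fst hp)
  have c2 : ContDiffAt ℝ ∞ (inChart e₂ p) y := contDiffAt_inChart_self (h.contMDiffAt_snd hp)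
  have d2 : DifferentiableAt ℝ (fderiv ℝ (inChart e₂ p)) y :=
    (c2.fderiv_right (m := 1) (WithTop.coe_le_coe.2 le_top)).differentiableAt (by simp)
  have hd : ∀ a b : R2, fderiv ℝ (formInChart (connForm e₂ e₁) p) y a b
      = ⟪inChart e₁ p y, fderiv ℝ (fderiv ℝ (inChart e₂ p)) y a b⟫
        + ⟪fderiv ℝ (inChart e₁ p) y a, fderiv ℝ (inChart e₂ p) y b⟫ := by
    intro a b
    have h0 : HasFDerivAt (fun z => innerSL ℝ (inChart e₁ p z))
        ((innerSL ℝ : R4 →L[ℝ] R4 →L[ℝ] ℝ).comp (fderiv ℝ (inChart e₁ p) y)) y :=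
      (innerSL ℝ : R4 →L[ℝ] R4 →L[ℝ] ℝ).hasFDerivAt.comp y d1.hasFDerivAt
    rw [hc.fderiv_eq, (h0.clm_comp d2.hasFDerivAt).fderiv]
    simp
  have hs : ∀ a b : R2, fderiv ℝ (fderiv ℝ (inChart e₂ p)) y a b
      = fderiv ℝ (fderiv ℝ (inChart e₂ p)) y b a := 
    (c2.isSymmSndFDerivAt (by
      rw [minSmoothness_of_isRCLikeNormedField]
      exact WithTop.coe_le_coe.2 (le_top : (2 : ℕ∞) ≤ ⊤)))
  rw [← fderiv_inChart_mfderiv (h.mdiff_fst hp), ← fderiv_inChart_mfderiv (h.mdiff_snd hp),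
    ← fderiv_inChart_mfderiv (h.mdiff_fst hp), ← fderiv_inChart_mfderiv (h.mdiff_snd hp)]
  refine (congrArg₂ (· - ·) (hd _ _) (hd _ _)).trans ?_
  rw [hs]
  abel

/-- The Gauss equation. -/
theorem isGaussianCurvatureAt [IsManifold (𝓡 2) ∞ M] {f N : M → R4} (hS : IsOrientedSurface f N)
    {p : M} {l₁ l₂ : ℝ} (hl : ArePrincipalCurvaturesAt f N p l₁ l₂) :
    IsGaussianCurvatureAt f p (1 + l₁ * l₂) := by
  intro U e₁ e₂ h hp v w
  -- The tangential components contribute nothing: `de₁` has no `e₁`-component and `de₂` no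
  -- `e₂`-component. Only the components along `N` and `f` survive.
  have hin : ∀ a b : TangentSpace (𝓡 2) p, ⟪diffl e₁ p a, diffl e₂ p b⟫
      = ⟪diffl N p a, e₁ p⟫ * ⟪diffl N p b, e₂ p⟫
        + ⟪diffl f p a, e₁ p⟫ * ⟪diffl f p b, e₂ p⟫ := by
    intro a b
    conv_lhs => rw [h.expansion hS hp (diffl e₁ p a)]
    simp only [inner_add_left, inner_smul_left, RCLike.conj_to_real]
    rw [real_inner_comm _ (e₂ p), real_inner_comm _ (N p), real_inner_comm _ (f p),
      h.inner_diffl_fst_fst hp, h.symm.inner_diffl_fst_fst hp, h.inner_diffl_fst_normal hS hp,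
      h.symm.inner_diffl_fst_normal hS hp, h.inner_diffl_fst_self hS hp,
      h.symm.inner_diffl_fst_self hS hp]
    ring
  rw [extDerivOneForm_connForm h hp, hin, hin, wedge]
  simp only [coframe_apply]
  -- The given frame need not be principal. In the principal basis `dN` is diagonal, so the
  -- `N`-terms give its determinant `l₁ l₂` times `θ¹ ∧ θ²`.
  obtain ⟨v₁, v₂, -, -, -, hv, w1, w2⟩ := exists_principal_directions hS hl
  rw [hv v, hv w]
  simp only [map_add, map_smul, w1, w2, inner_add_left, inner_smul_left, RCLike.conj_to_real,
    neg_smul, inner_neg_left]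
  ring

namespace IsPrincipalFrameOn

variable {f N : M → R4} {U : Set M} {e₁ e₂ : M → R4} {l₁ l₂ : ℝ}
  (h : IsPrincipalFrameOn f N l₁ l₂ U e₁ e₂) (hS : IsOrientedSurface f N)
include h

theorem symm : IsPrincipalFrameOn f N l₂ l₁ U e₂ e₁ :=
  ⟨h.toIsTangentFrameOn.symm, h.diag_snd, h.diag_fst⟩

include hS

theorem inner_diffl_normal_fst {p : M} (hp : p ∈ U) (v : TangentSpace (𝓡 2) p) :
    ⟪diffl N p v, e₁ p⟫ = -l₁ * ⟪diffl f p v, e₁ p⟫ := by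
  have h1 := congrArg (fun L => L v) (h.diag_fst p hp)
  have h2 := h.inner_diffl_fst_normal hS hp v
  simp only [connForm_apply, FunLike.coe_smul, Pi.smul_apply, coframe_apply, smul_eq_mul] at h1
  linarith

/-- Adding `l₂ df` cancels the `e₂`-component of `dN`, leaving a form of rank at most one. -/
theorem diffl_normal {p : M} (hp : p ∈ U) (v : TangentSpace (𝓡 2) p) :
    diffl N p v + l₂ • diffl f p v = ((l₂ - l₁) * ⟪diffl f p v, e₁ p⟫) • e₁ p := by
  conv_lhs => rw [h.expansion hS hp (diffl f p v), h.expansion hS hp (diffl N p v)]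
  rw [h.inner_diffl_normal_fst hS hp, h.symm.inner_diffl_normal_fst hS hp,
    hS.inner_diffl_normal_normal, hS.inner_diffl_normal_self, hS.normal_orthogonal,
    hS.inner_diffl_self]
  module

variable [IsManifold (𝓡 2) ∞ M]

/-- One of the two Codazzi equations for constant principal curvatures: `θ¹ ∧ ω₂¹ = 0`. -/
theorem coframe_wedge_connForm (hne : l₁ ≠ l₂) {p : M} (hp : p ∈ U)
    (v w : TangentSpace (𝓡 2) p) :
    ⟪diffl f p v, e₁ p⟫ * ⟪diffl e₂ p w, e₁ p⟫ = ⟪diffl f p w, e₁ p⟫ * ⟪diffl e₂ p v, e₁ p⟫ := by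
  have cf := contDiffAt_inChart_self (hS.contMDiff p)
  have cN := contDiffAt_inChart_self (hS.contMDiff_normal p)
  have hfd : ∀ z ∈ (extChartAt (𝓡 2) p).target, ∀ a : R2,
      fderiv ℝ (inChart N p + l₂ • inChart f p) z a
        = fderiv ℝ (inChart N p) z a + l₂ • fderiv ℝ (inChart f p) z a := by
    intro z hz a
    have df := (contDiffAt_inChart hz (hS.contMDiff _)).differentiableAt (by simp)
    have dN := (contDiffAt_inChart hz (hS.contMDiff_normal _)).differentiableAt (by simp)
    rw [fderiv_add dN (df.const_smul l₂), fderiv_const_smul df]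
    rfl
  -- The differential of `N + l₂ f` is a multiple of `e₁`, so `e₂` is a normal field along this map.
  have key := inner_fderiv_symm (g := inChart N p + l₂ • inChart f p) (E := inChart e₂ p)
    (cN.add (cf.const_smul l₂)) (differentiableAt_inChart (h.mdiff_snd hp)) (by
      filter_upwards [eventually_inChart (h.isOpen.mem_nhds hp)] with z hz a
      rw [hfd z hz.1, fderiv_inChart hz.1 (hS.mdiff _), fderiv_inChart hz.1 (hS.mdiff_normal _),
        h.diffl_normal hS hz.2, inner_smul_left]
      have := h.orthogonal _ hz.2
      simp only [inChart, Function.comp_apply, this, mul_zero]) v w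
  have hm := mem_extChartAt_target (I := 𝓡 2) p
  have key : ⟪diffl N p v + l₂ • diffl f p v, diffl e₂ p w⟫
      = ⟪diffl N p w + l₂ • diffl f p w, diffl e₂ p v⟫ := by
    rw [diffl_eq_fderiv (hS.mdiff p), diffl_eq_fderiv (hS.mdiff_normal p),
      diffl_eq_fderiv (hS.mdiff p), diffl_eq_fderiv (hS.mdiff_normal p),
      diffl_eq_fderiv (h.mdiff_snd hp), diffl_eq_fderiv (h.mdiff_snd hp)]
    exact (congrArg (⟪·, _⟫) (hfd _ hm v).symm).trans
      (key.trans (congrArg (⟪·, _⟫) (hfd _ hm w)))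
  rw [h.diffl_normal hS hp, h.diffl_normal hS hp, inner_smul_left, inner_smul_left,
    real_inner_comm (diffl e₂ p w), real_inner_comm (diffl e₂ p v)] at key
  simp only [RCLike.conj_to_real] at key
  apply mul_left_cancel₀ (sub_ne_zero.2 hne.symm)
  linarith

theorem connForm_eq_zero (hne : l₁ ≠ l₂) {p : M} (hp : p ∈ U) : connForm e₁ e₂ p = 0 := by
  obtain ⟨v₁, hv₁⟩ := h.tangent_fst p hp
  obtain ⟨v₂, hv₂⟩ := h.tangent_snd p hp
  have i1 : ⟪e₁ p, e₁ p⟫ = 1 := by rw [real_inner_self_eq_norm_sq, h.norm_fst p hp]; norm_num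
  have i2 : ⟪e₂ p, e₂ p⟫ = 1 := by rw [real_inner_self_eq_norm_sq, h.norm_snd p hp]; norm_num
  have i3 := h.orthogonal p hp
  have i4 := h.symm.orthogonal p hp
  ext w
  -- Evaluated on the dual vectors, one Codazzi equation gives `ω₂¹(v₂) = 0`, the other `ω₁²(v₁) =
  -- 0`. By antisymmetry `ω₂¹(v₁) = 0`, and the first equation on `(v₁, w)` gives `ω₂¹(w) = 0` for
  -- every `w`.
  have a1 := h.coframe_wedge_connForm hS hne hp v₁ w
  have a2 := h.coframe_wedge_connForm hS hne hp v₁ v₂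
  have b1 := h.symm.coframe_wedge_connForm hS hne.symm hp v₂ w
  have b2 := h.symm.coframe_wedge_connForm hS hne.symm hp v₂ v₁
  have c1 := h.inner_diffl_snd_fst hp v₁
  rw [hv₁, hv₂, i1, i4] at a2
  rw [hv₁, hv₂, i2, i3] at b2
  rw [hv₂, i2] at b1
  rw [hv₁, i1] at a1
  have c2 := h.inner_diffl_snd_fst hp v₂
  have c3 := h.inner_diffl_snd_fst hp w
  have e1 : ⟪diffl e₂ p v₁, e₁ p⟫ = 0 := by linarith
  have e2 : ⟪diffl e₁ p v₂, e₂ p⟫ = 0 := by linarith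
  rw [e1] at a1
  rw [connForm_apply]
  change _ = (0 : ℝ)
  linarith

/-- A principal frame with `ω₁² = 0` forces `1 + λ₁ λ₂ = 0`. -/
theorem one_add_mul_eq_zero (hne : l₁ ≠ l₂) {p : M} (hp : p ∈ U)
    (hK : IsGaussianCurvatureAt f p (1 + l₁ * l₂)) : 1 + l₁ * l₂ = 0 := by
  obtain ⟨v₁, hv₁⟩ := h.tangent_fst p hp
  obtain ⟨v₂, hv₂⟩ := h.tangent_snd p hp
  have hc : formInChart (connForm e₂ e₁) p =ᶠ[nhds (extChartAt (𝓡 2) p p)] fun _ => 0 := by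
    filter_upwards [eventually_inChart (h.isOpen.mem_nhds hp)] with z hz
    rw [formInChart, h.symm.connForm_eq_zero hS hne.symm hz.2]
    exact ContinuousLinearMap.zero_comp _
  have h0 : extDerivOneForm (connForm e₂ e₁) p v₁ v₂ = 0 := by
    simp only [extDerivOneForm]
    rw [hc.fderiv_eq, fderiv_fun_const]
    exact sub_self _
  have := hK U e₁ e₂ h.toIsTangentFrameOn hp v₁ v₂
  rw [h0, wedge, coframe_apply, coframe_apply, coframe_apply, coframe_apply, hv₁, hv₂,
    real_inner_self_eq_norm_sq, real_inner_self_eq_norm_sq, h.norm_fst p hp, h.norm_snd p hp,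
    h.orthogonal p hp] at this
  linarith

end IsPrincipalFrameOn

end

/-! ### Existence of smooth principal frames. -/

section

variable {M : Type*} [TopologicalSpace M] [ChartedSpace R2 M]

/-- Normalization recovers `u` only up to a sign; the principal frame equations do not depend on
that sign. -/
theorem exists_normalize_smul_eq {u : R4} (hu : ‖u‖ = 1) {c : ℝ} (hc : c • u ≠ 0) :
    ∃ s : ℝ, s * s = 1 ∧ ‖c • u‖⁻¹ • (c • u) = s • u := by
  have h0 : c ≠ 0 := fun h => hc (by rw [h, zero_smul])
  refine ⟨|c|⁻¹ * c, ?_, ?_⟩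
  · have := abs_mul_abs_self c
    field_simp
    rw [sq_abs]
  · rw [norm_smul, hu, mul_one, smul_smul, Real.norm_eq_abs]

theorem contDiffAt_normalize {x : R4} (hx : x ≠ 0) :
    ContDiffAt ℝ ∞ (fun y : R4 => ‖y‖⁻¹ • y) x :=
  ((contDiffAt_norm ℝ hx).inv (norm_ne_zero_iff.2 hx)).smul contDiffAt_id

/-- The field `D_w N + l D_w f` on the domain of the chart at `p`, for a chart direction `w`. -/
def weingartenField (f N : M → R4) (p : M) (l : ℝ) (w : R2) (q : M) : R4 :=
  fderiv ℝ (inChart N p) (extChartAt (𝓡 2) p q) w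
    + l • fderiv ℝ (inChart f p) (extChartAt (𝓡 2) p q) w

variable [IsManifold (𝓡 2) ∞ M] {f N : M → R4} (hS : IsOrientedSurface f N)
include hS

theorem contMDiffAt_weingartenField {p q : M} (hq : q ∈ (extChartAt (𝓡 2) p).source) (l : ℝ)
    (w : R2) : ContMDiffAt (𝓡 2) 𝓘(ℝ, R4) ∞ (weingartenField f N p l w) q := by
  have hz := (extChartAt (𝓡 2) p).map_source hq
  have c1 : ∀ F : M → R4, ContMDiff (𝓡 2) 𝓘(ℝ, R4) ∞ F →
      ContDiffAt ℝ ∞ (fun z => fderiv ℝ (inChart F p) z w) (extChartAt (𝓡 2) p q) := fun F hF =>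
    ((contDiffAt_inChart hz (hF _)).fderiv_right (m := ∞) (by simp)).clm_apply contDiffAt_const
  have c2 : ContDiffAt ℝ ∞
      (fun z => fderiv ℝ (inChart N p) z w + l • fderiv ℝ (inChart f p) z w)
      (extChartAt (𝓡 2) p q) :=
    (c1 N hS.contMDiff_normal).add ((c1 f hS.contMDiff).const_smul l)
  exact c2.contMDiffAt.comp q (contMDiffAt_extChartAt' (by simpa using hq))

/-- Smooth principal frames exist around every point of a surface with two distinct constant
principal curvatures. -/
theorem exists_isPrincipalFrameOn {l₁ l₂ : ℝ} (hl : ∀ p, ArePrincipalCurvaturesAt f N p l₁ l₂)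
    (hne : l₁ ≠ l₂) (p : M) :
    ∃ (U : Set M) (e₁ e₂ : M → R4), p ∈ U ∧ IsPrincipalFrameOn f N l₁ l₂ U e₁ e₂ := by
  obtain ⟨v₁, v₂, n1, n2, -, -, w1, w2⟩ := exists_principal_directions hS (hl p)
  let dφ : TangentSpace (𝓡 2) p →L[ℝ] R2 := mfderiv (𝓡 2) 𝓘(ℝ, R2) (extChartAt (𝓡 2) p) p
  -- The coefficient is the other curvature, so `D₁` has no component in the second principal
  -- direction. The chart direction `dφ v₁` is frozen, and at `p` the value is `(l₂ - l₁) df(v₁) ≠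
  -- 0`.
  let D₁ := weingartenField f N p l₂ (dφ v₁)
  let D₂ := weingartenField f N p l₁ (dφ v₂)
  let S := (extChartAt (𝓡 2) p).source
  have hSo : IsOpen S := isOpen_extChartAt_source p
  have c1 : ∀ q ∈ S, ContMDiffAt (𝓡 2) 𝓘(ℝ, R4) ∞ D₁ q := fun q hq =>
    contMDiffAt_weingartenField hS hq _ _
  have c2 : ∀ q ∈ S, ContMDiffAt (𝓡 2) 𝓘(ℝ, R4) ∞ D₂ q := fun q hq =>
    contMDiffAt_weingartenField hS hq _ _
  have hDp : ∀ (l : ℝ) (v : TangentSpace (𝓡 2) p),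
      weingartenField f N p l (dφ v) p = diffl N p v + l • diffl f p v := fun l v => by
    rw [← fderiv_inChart_mfderiv (hS.mdiff p), ← fderiv_inChart_mfderiv (hS.mdiff_normal p)]
    rfl
  have hp1 : D₁ p ≠ 0 := by
    simp only [D₁]
    rw [hDp, w1, ← add_smul]
    exact smul_ne_zero (fun h => hne (by linarith)) (norm_ne_zero_iff.1 (by rw [n1]; simp))
  have hp2 : D₂ p ≠ 0 := by
    simp only [D₂]
    rw [hDp, w2, ← add_smul]
    exact smul_ne_zero (fun h => hne (by linarith)) (norm_ne_zero_iff.1 (by rw [n2]; simp))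
  let U : Set M := (S ∩ D₁ ⁻¹' {0}ᶜ) ∩ (S ∩ D₂ ⁻¹' {0}ᶜ)
  have hU : IsOpen U :=
    (ContinuousOn.isOpen_inter_preimage (fun q hq => (c1 q hq).continuousAt.continuousWithinAt)
      hSo isOpen_compl_singleton).inter
    (ContinuousOn.isOpen_inter_preimage (fun q hq => (c2 q hq).continuousAt.continuousWithinAt)
      hSo isOpen_compl_singleton)
  let e₁ : M → R4 := fun q => ‖D₁ q‖⁻¹ • D₁ q
  let e₂ : M → R4 := fun q => ‖D₂ q‖⁻¹ • D₂ q
  -- The directions `u₁, u₂` are chosen point by point without any continuity. They serve only for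
  -- pointwise identities; smoothness of the frame comes from `D₁` and `D₂`.
  have main : ∀ q ∈ U, ∃ (u₁ u₂ : TangentSpace (𝓡 2) q) (s₁ s₂ : ℝ), s₁ * s₁ = 1 ∧ s₂ * s₂ = 1 ∧
      e₁ q = s₁ • diffl f q u₁ ∧ e₂ q = s₂ • diffl f q u₂ ∧
      ‖diffl f q u₁‖ = 1 ∧ ‖diffl f q u₂‖ = 1 ∧ ⟪diffl f q u₁, diffl f q u₂⟫ = 0 ∧
      (∀ v, diffl N q v = (-l₁ * ⟪diffl f q v, diffl f q u₁⟫) • diffl f q u₁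
        + (-l₂ * ⟪diffl f q v, diffl f q u₂⟫) • diffl f q u₂) := by
    rintro q ⟨⟨hqS, hq1⟩, -, hq2⟩
    obtain ⟨u₁, u₂, n1, n2, o, hv, w1, w2⟩ := exists_principal_directions hS (hl q)
    have hW : ∀ v, diffl N q v = (-l₁ * ⟪diffl f q v, diffl f q u₁⟫) • diffl f q u₁
        + (-l₂ * ⟪diffl f q v, diffl f q u₂⟫) • diffl f q u₂ := fun v => by
      conv_lhs => rw [hv v]
      simp only [map_add, map_smul, w1, w2]
      module
    have hV : ∀ v, diffl f q v = ⟪diffl f q v, diffl f q u₁⟫ • diffl f q u₁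
        + ⟪diffl f q v, diffl f q u₂⟫ • diffl f q u₂ := fun v => by
      conv_lhs => rw [hv v]
      simp only [map_add, map_smul]
    obtain ⟨x₁, hx₁⟩ := exists_tangent_of_chart_direction hqS (dφ v₁)
    obtain ⟨x₂, hx₂⟩ := exists_tangent_of_chart_direction hqS (dφ v₂)
    have hD₁ : D₁ q = ((l₂ - l₁) * ⟪diffl f q x₁, diffl f q u₁⟫) • diffl f q u₁ := by
      simp only [D₁, weingartenField]
      rw [hx₁ N (hS.mdiff_normal q), hx₁ f (hS.mdiff q), hW]
      conv_lhs => enter [2, 2]; rw [hV x₁]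
      module
    have hD₂ : D₂ q = ((l₁ - l₂) * ⟪diffl f q x₂, diffl f q u₂⟫) • diffl f q u₂ := by
      simp only [D₂, weingartenField]
      rw [hx₂ N (hS.mdiff_normal q), hx₂ f (hS.mdiff q), hW]
      conv_lhs => enter [2, 2]; rw [hV x₂]
      module
    have z1 : D₁ q ≠ 0 := hq1
    have z2 : D₂ q ≠ 0 := hq2
    rw [hD₁] at z1
    rw [hD₂] at z2
    obtain ⟨s₁, hs₁, hn₁⟩ := exists_normalize_smul_eq n1 z1
    obtain ⟨s₂, hs₂, hn₂⟩ := exists_normalize_smul_eq n2 z2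
    rw [← hD₁] at hn₁
    rw [← hD₂] at hn₂
    exact ⟨u₁, u₂, s₁, s₂, hs₁, hs₂, hn₁, hn₂, n1, n2, o, hW⟩
  have habs : ∀ s : ℝ, s * s = 1 → ‖s‖ = 1 := fun s hs => by
    rw [Real.norm_eq_abs]
    nlinarith [abs_mul_abs_self s, abs_nonneg s]
  have hframe : IsTangentFrameOn f U e₁ e₂ := by
    refine ⟨hU, fun q hq => ?_, fun q hq => ?_, fun q hq => ?_, fun q hq => ?_, fun q hq => ?_,
      fun q hq => ?_, fun q hq => ?_⟩
    · exact ((contDiffAt_normalize hq.1.2).contMDiffAt.comp q (c1 q hq.1.1)).contMDiffWithinAt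
    · exact ((contDiffAt_normalize hq.2.2).contMDiffAt.comp q (c2 q hq.1.1)).contMDiffWithinAt
    all_goals obtain ⟨u₁, u₂, s₁, s₂, hs₁, hs₂, h1, h2, n1, n2, o, hW⟩ := main q hq
    · exact ⟨s₁ • u₁, by rw [map_smul, h1]⟩
    · exact ⟨s₂ • u₂, by rw [map_smul, h2]⟩
    · rw [h1, norm_smul, n1, habs _ hs₁, one_mul]
    · rw [h2, norm_smul, n2, habs _ hs₂, one_mul]
    · rw [h1, h2, inner_smul_left, inner_smul_right, o, mul_zero, mul_zero]
  refine ⟨U, e₁, e₂, ⟨⟨mem_extChartAt_source p, hp1⟩, mem_extChartAt_source p, hp2⟩, hframe,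
    fun q hq => ?_, fun q hq => ?_⟩
  all_goals
    obtain ⟨u₁, u₂, s₁, s₂, hs₁, hs₂, h1, h2, n1, n2, o, hW⟩ := main q hq
    have o' := (real_inner_comm _ _).trans o
    ext v
    rw [connForm_apply, FunLike.coe_smul, Pi.smul_apply, coframe_apply, smul_eq_mul]
  · rw [hframe.inner_diffl_fst_normal hS hq, h1, hW]
    simp only [inner_add_left, inner_smul_left, inner_smul_right, RCLike.conj_to_real,
      real_inner_self_eq_norm_sq, n1, o']
    ring
  · rw [hframe.symm.inner_diffl_fst_normal hS hq, h2, hW]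
    simp only [inner_add_left, inner_smul_left, inner_smul_right, RCLike.conj_to_real,
      real_inner_self_eq_norm_sq, n2, o]
    ring

end

end S3Surface

end

theorem mainTheorem4 {M : Type*} [TopologicalSpace M] [ConnectedSpace M]
    [ChartedSpace R2 M] [IsManifold (𝓡 2) ∞ M]
    (f N : M → R4) (hS : IsOrientedSurface f N)
    (l₁ l₂ : ℝ) (hconst : ∀ p, ArePrincipalCurvaturesAt f N p l₁ l₂) :
    (l₁ = l₂ ∧ IsUmbilic f N) ∨
    ((∀ p, ∃ (U : Set M) (e₁ e₂ : M → R4), p ∈ U ∧ IsPrincipalFrameOn f N l₁ l₂ U e₁ e₂) ∧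
      (∀ (U : Set M) (e₁ e₂ : M → R4), IsPrincipalFrameOn f N l₁ l₂ U e₁ e₂ →
        ∀ p ∈ U, connForm e₁ e₂ p = 0) ∧
      (∀ p, IsGaussianCurvatureAt f p (1 + l₁ * l₂)) ∧
      1 + l₁ * l₂ = 0) := by
  by_cases hne : l₁ = l₂
  · subst hne
    exact Or.inl ⟨rfl, isUmbilic_of_eq hS hconst⟩
  have hfr := exists_isPrincipalFrameOn hS hconst hne
  refine Or.inr ⟨hfr, fun U e₁ e₂ h p hp => h.connForm_eq_zero hS hne hp,
    fun p => isGaussianCurvatureAt hS (hconst p), ?_⟩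
  -- The identity `1 + l₁ l₂ = 0` concerns constants, so one point suffices; a connected space has
  -- one.
  obtain ⟨p⟩ := (inferInstance : Nonempty M)
  obtain ⟨U, e₁, e₂, hp, h⟩ := hfr p
  exact h.one_add_mul_eq_zero hS hne hp (isGaussianCurvatureAt hS (hconst p))
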